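/- Fix $p$, $\beta^*\in\mathbb R^p$ and $\sigma>0$. For each $n$ let $X=X^{(n)}$ be an $n\times p$ design matrix and let $y=X\beta^*+\varepsilon$, where $\varepsilon_1,\dots,\varepsilon_n$ are i.i.d. $N(0,\sigma^2)$; assume $\frac1n X^TX\to C$ with $C$ positive definite. For $\lambda\ge 0$ let $\hat\beta(\lambda)$ be the lasso estimate, the minimizer over $\beta\in\mathbb R^p$ of $\|y-X\beta\|^2+\lambda\sum_{j=1}^p|\beta_j|$ (it is unique for all large $n$), let $\hat\mu_\lambda=X\hat\beta(\lambda)$ be the lasso fit, $\mathcal B_\lambda=\{j:\hat\beta(\lambda)_j\ne0\}$ its active set, $\widehat{df}(\lambda)=|\mathcal B_\lambda|$, and $df(\lambda)=\sum_{i=1}^n\operatorname{cov}((\hat\mu_\lambda)_i,y_i)/\sigma^2$ the degrees of freedom of the lasso fit. For $\lambda>0$ let $b(\lambda)$ be the unique minimizer over $\beta$ of $$Z_\lambda(\beta)=(\beta-\beta^*)^TC(\beta-\beta^*)+\lambda\sum_{j=1}^p|\beta_j| .$$ A number $\lambda>0$ is a transition point of this limiting problem if the active set $\{j:b(\cdot)_j\neq0\}$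 and the sign vector of $b(\cdot)$ are not both constant on any neighbourhood of $\lambda$. Suppose that $\lambda_n/n\to\lambda^*>0$, where $\lambda^*$ is not a transition point of the limiting problem, and that the limiting problem is nondegenerate at $\lambda^*$: there is no index $j$ such that $b(\lambda)_j=0$ and $2\,|(C(\beta^*-b(\lambda)))_j|=\lambda$ for all $\lambda$ in a neighbourhood of $\lambda^*$. Then $$\widehat{df}(\lambda_n)-df(\lambda_n)\to0\quad\text{in probability as } n\to\infty .$$ -/

import Mathlib

open MeasureTheory ProbabilityTheory Filter Topology
open scoped Matrix NNReal

noncomputable section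

/-- The lasso criterion `‖y - X β‖² + lam * ∑ⱼ |βⱼ|`. -/
def lassoObjective {n p : ℕ} (X : Matrix (Fin n) (Fin p) ℝ) (y : Fin n → ℝ) (lam : ℝ)
    (β : Fin p → ℝ) : ℝ :=
  ∑ i, (y i - (X *ᵥ β) i) ^ 2 + lam * ∑ j, |β j|

/-- The lasso coefficients: a minimizer of the lasso criterion. It exists and is unique when
`X` has full column rank and `0 ≤ lam`; otherwise some minimizer is picked (if there is one). -/
def lassoCoef {n p : ℕ} (X : Matrix (Fin n) (Fin p) ℝ) (y : Fin n → ℝ) (lam : ℝ) : Fin p → ℝ :=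
  Classical.epsilon fun b => ∀ β, lassoObjective X y lam b ≤ lassoObjective X y lam β

/-- The lasso fit `X β̂`. -/
def lassoFit {n p : ℕ} (X : Matrix (Fin n) (Fin p) ℝ) (lam : ℝ) (y : Fin n → ℝ) : Fin n → ℝ :=
  X *ᵥ lassoCoef X y lam

/-- The active set: the indices of the nonzero coefficients. -/
def activeSet {p : ℕ} (β : Fin p → ℝ) : Finset (Fin p) := {j | β j ≠ 0}

/-- The sign vector. -/
def signVector {p : ℕ} (β : Fin p → ℝ) : Fin p → SignType := fun j => SignType.sign (β j)

/-- Degrees of freedom of a fitting procedure `δ` applied to a random response `y` whose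
coordinates have common variance `σ ^ 2`: `∑ᵢ cov (δ(y)ᵢ, yᵢ) / σ ^ 2`. -/
def degreesOfFreedom {Ω : Type*} [MeasurableSpace Ω] (P : Measure Ω) {n : ℕ}
    (δ : (Fin n → ℝ) → Fin n → ℝ) (y : Ω → Fin n → ℝ) (σ : ℝ) : ℝ :=
  ∑ i, covariance (fun ω => δ (y ω) i) (fun ω => y ω i) P / σ ^ 2

/-- The limiting criterion `(β - βs)ᵀ C (β - βs) + lam * ∑ⱼ |βⱼ|`. -/
def limitObjective {p : ℕ} (C : Matrix (Fin p) (Fin p) ℝ) (βs : Fin p → ℝ) (lam : ℝ)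
    (β : Fin p → ℝ) : ℝ :=
  (β - βs) ⬝ᵥ (C *ᵥ (β - βs)) + lam * ∑ j, |β j|

/-- The minimizer of the limiting criterion (unique for `C` positive definite, `0 ≤ lam`). -/
def limitCoef {p : ℕ} (C : Matrix (Fin p) (Fin p) ℝ) (βs : Fin p → ℝ) (lam : ℝ) : Fin p → ℝ :=
  Classical.epsilon fun b => ∀ β, limitObjective C βs lam b ≤ limitObjective C βs lam β

/-- The transition points of a solution path `lam ↦ b lam` on `[0, ∞)`: the end point `0`, and
the points in no neighbourhood of which active set and sign vector are both constant. -/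
def IsTransitionPoint {p : ℕ} (b : ℝ → Fin p → ℝ) (lam : ℝ) : Prop :=
  lam = 0 ∨ 0 < lam ∧ ¬ ∀ᶠ l in 𝓝 lam,
    activeSet (b l) = activeSet (b lam) ∧ signVector (b l) = signVector (b lam)

/-- Predictor `j` is degenerate at `lam`: on a whole neighbourhood of `lam` its coefficient in
the limiting problem is zero and yet its optimality bound `2 |Cⱼ (βs - β̂)| ≤ l` is attained. -/
def IsDegenerateAt {p : ℕ} (C : Matrix (Fin p) (Fin p) ℝ) (βs : Fin p → ℝ) (lam : ℝ)
    (j : Fin p) : Prop :=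
  ∀ᶠ l in 𝓝 lam, limitCoef C βs l j = 0 ∧ 2 * |(C *ᵥ (βs - limitCoef C βs l)) j| = l

end

/-! Divide the lasso criterion by `n`. Up to a constant it becomes a quadratic criterion governed by
`G = XᵀX / n`, the score `W = Xᵀε / n` and `lam / n`; the limiting problem has data `C`, `0`,
`lamStar`. At `lamStar` the active coefficients are nonzero and the optimality bounds of the
inactive ones are strict (`abs_gradient_lt_of_not_isDegenerateAt`). Both conditions are open, so for
large `n`, whenever `‖W‖ < δ`, the lasso solution is the explicit `restrictedSolution`, affine in
`W`, with the limiting active set `A` (`exists_eventually_isPerturbedMinimizer_restrictedSolution`).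
Both sides of the claim then approach `|A|`. The active set equals `A` off the event `‖W‖ ≥ δ`,
whose probability tends to `0` by a fourth-moment Markov bound. The degrees of freedom equal `n /
σ²` times the mean of `β̂ ⬝ᵥ W`. If `β̂` is replaced by the affine solution, this mean is a trace
and gives exactly `|A|` (`trace_restrictedGram_inv_mul`), so no Stein identity is needed. The
replacement costs nothing when `‖W‖ < δ`. Otherwise Lipschitz bounds in `W` make the cost `O(‖W‖²)`,
hence `O(‖W‖⁴)`, whose mean is `O(n⁻²)` and beats the factor `n`
(`abs_degreesOfFreedom_sub_card_le`). -/

/-! ### Coercivity constants uniform near `C` -/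

lemma abs_dotProduct_le {p : ℕ} (v w : Fin p → ℝ) : |v ⬝ᵥ w| ≤ p * (‖v‖ * ‖w‖) := by
  calc |v ⬝ᵥ w| ≤ ∑ j, |v j * w j| := Finset.abs_sum_le_sum_abs _ _
    _ ≤ ∑ _j : Fin p, ‖v‖ * ‖w‖ := by
        refine Finset.sum_le_sum fun j _ => ?_
        rw [abs_mul]
        exact mul_le_mul (norm_le_pi_norm v j) (norm_le_pi_norm w j) (abs_nonneg _) (norm_nonneg _)
    _ = p * (‖v‖ * ‖w‖) := by simp

/-- `c ‖d‖² ≤ dᵀ G d` for all `d`, with the sup norm. -/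
def QuadLowerBound {p : ℕ} (c : ℝ) (G : Matrix (Fin p) (Fin p) ℝ) : Prop :=
  ∀ d : Fin p → ℝ, c * ‖d‖ ^ 2 ≤ d ⬝ᵥ (G *ᵥ d)

/-- The constant is the minimum of the form on the compact unit sphere; homogeneity does the rest.
The sphere is empty when `p = 0`, hence the separate case. -/
lemma quadLowerBound_of_posDef {p : ℕ} {C : Matrix (Fin p) (Fin p) ℝ} (hC : C.PosDef) :
    ∃ c > 0, QuadLowerBound c C := by
  rcases Nat.eq_zero_or_pos p with rfl | hp
  · exact ⟨1, one_pos, fun d => by simp [Subsingleton.elim d 0]⟩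
  have : Nonempty (Fin p) := ⟨⟨0, hp⟩⟩
  have hne : (Metric.sphere (0 : Fin p → ℝ) 1).Nonempty :=
    NormedSpace.sphere_nonempty.2 zero_le_one
  have hcont : Continuous fun d : Fin p → ℝ => d ⬝ᵥ (C *ᵥ d) := by fun_prop
  obtain ⟨d₀, hd₀, hmin⟩ :=
    (isCompact_sphere (0 : Fin p → ℝ) 1).exists_isMinOn hne hcont.continuousOn
  have hd₀' : d₀ ≠ 0 := by
    rintro rfl
    simp at hd₀
  refine ⟨d₀ ⬝ᵥ (C *ᵥ d₀), by simpa using hC.dotProduct_mulVec_pos hd₀', fun d => ?_⟩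
  rcases eq_or_ne d 0 with rfl | hd
  · simp
  have hn : ‖d‖ ≠ 0 := norm_ne_zero_iff.2 hd
  have h1 : ‖d‖⁻¹ • d ∈ Metric.sphere (0 : Fin p → ℝ) 1 := by
    simp [norm_smul, hn]
  have h2 := hmin h1
  simp only [Set.mem_ofPred_eq, Matrix.mulVec_smul, dotProduct_smul, smul_dotProduct,
    smul_eq_mul] at h2
  calc d₀ ⬝ᵥ (C *ᵥ d₀) * ‖d‖ ^ 2
      ≤ (‖d‖⁻¹ * (‖d‖⁻¹ * (d ⬝ᵥ (C *ᵥ d)))) * ‖d‖ ^ 2 := by gcongr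
    _ = d ⬝ᵥ (C *ᵥ d) := by field_simp

/-- Perturbing the entries changes the form by at most the `ℓ¹` entry error times `‖d‖²`, so half
the constant of `C` survives nearby. One `c` then serves all large `n`. -/
lemma eventually_quadLowerBound {p : ℕ} {C : Matrix (Fin p) (Fin p) ℝ} (hC : C.PosDef) :
    ∃ c > 0, ∀ᶠ G in 𝓝 C, QuadLowerBound c G := by
  obtain ⟨c, hc, h⟩ := quadLowerBound_of_posDef hC
  have hcont : Continuous fun G : Matrix (Fin p) (Fin p) ℝ => ∑ i, ∑ j, |G i j - C i j| := by
    have (i j : Fin p) : Continuous fun G : Matrix (Fin p) (Fin p) ℝ => G i j :=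
      continuous_id.matrix_elem i j
    fun_prop
  refine ⟨c / 2, by positivity, ?_⟩
  have hlt : ∀ᶠ G in 𝓝 C, ∑ i, ∑ j, |G i j - C i j| < c / 2 :=
    hcont.continuousAt.eventually_lt continuousAt_const (by simpa using by positivity)
  filter_upwards [hlt] with G hG d
  have hdiff : |d ⬝ᵥ (G *ᵥ d) - d ⬝ᵥ (C *ᵥ d)| ≤ (∑ i, ∑ j, |G i j - C i j|) * ‖d‖ ^ 2 := by
    have : d ⬝ᵥ (G *ᵥ d) - d ⬝ᵥ (C *ᵥ d) = ∑ i, ∑ j, d i * ((G i j - C i j) * d j) := by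
      rw [← dotProduct_sub, ← Matrix.sub_mulVec]
      simp [dotProduct, Matrix.mulVec, Finset.mul_sum]
    rw [this, Finset.sum_mul]
    refine (Finset.abs_sum_le_sum_abs _ _).trans (Finset.sum_le_sum fun i _ => ?_)
    rw [Finset.sum_mul]
    refine (Finset.abs_sum_le_sum_abs _ _).trans (Finset.sum_le_sum fun j _ => ?_)
    rw [abs_mul, abs_mul]
    have hi : |d i| ≤ ‖d‖ := norm_le_pi_norm d i
    have hj : |d j| ≤ ‖d‖ := norm_le_pi_norm d j
    calc |d i| * (|G i j - C i j| * |d j|) ≤ ‖d‖ * (|G i j - C i j| * ‖d‖) := by gcongr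
      _ = _ := by ring
  have h1 := h d
  have h2 := (abs_le.1 hdiff).1
  nlinarith [sq_nonneg ‖d‖]

/-! ### Existence, stability and optimality conditions for the perturbed criterion -/

/-- The quadratic criterion `(β - βs)ᵀ G (β - βs) - 2 Wᵀ (β - βs) + lam * ∑ⱼ |βⱼ|`. -/
def perturbedObjective {p : ℕ} (G : Matrix (Fin p) (Fin p) ℝ) (βs W : Fin p → ℝ) (lam : ℝ)
    (β : Fin p → ℝ) : ℝ :=
  (β - βs) ⬝ᵥ (G *ᵥ (β - βs)) - 2 * (W ⬝ᵥ (β - βs)) + lam * ∑ j, |β j|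

/-- `b` minimizes the perturbed criterion. -/
def IsPerturbedMinimizer {p : ℕ} (G : Matrix (Fin p) (Fin p) ℝ) (βs W : Fin p → ℝ) (lam : ℝ)
    (b : Fin p → ℝ) : Prop :=
  ∀ β, perturbedObjective G βs W lam b ≤ perturbedObjective G βs W lam β

lemma exists_isPerturbedMinimizer {p : ℕ} {G : Matrix (Fin p) (Fin p) ℝ} {c : ℝ} (hc : 0 < c)
    (hG : QuadLowerBound c G) (βs W : Fin p → ℝ) {lam : ℝ} (hlam : 0 ≤ lam) :
    ∃ b, IsPerturbedMinimizer G βs W lam b := by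
  have hcont : Continuous (perturbedObjective G βs W lam) := by
    unfold perturbedObjective
    fun_prop
  set S := lam * ∑ j, |βs j| with hS
  have hS0 : 0 ≤ S := by positivity
  -- Beyond this radius `‖d‖ ≥ 1` and `c‖d‖ ≥ 2p‖W‖ + S`, so the quadratic term dominates the linear
  -- one plus `S`, the value at `βs`.
  set R := 1 + (2 * p * ‖W‖ + S) / c with hR
  have hR1 : 1 ≤ R := by
    have : 0 ≤ (2 * p * ‖W‖ + S) / c := by positivity
    linarith
  refine hcont.exists_forall_le' βs ?_
  have hmem : Metric.closedBall βs R ∈ 𝓝 βs := Metric.closedBall_mem_nhds _ (by linarith)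
  have hco : (Metric.closedBall βs R)ᶜ ∈ cocompact (Fin p → ℝ) :=
    (isCompact_closedBall βs R).compl_mem_cocompact
  filter_upwards [hco] with β hβ
  have hd : R < ‖β - βs‖ := by
    simpa [Metric.mem_closedBall, dist_eq_norm] using hβ
  set d := β - βs with hd'
  have h1 := hG d
  have h2 := (abs_le.1 (abs_dotProduct_le W d)).2
  have h3 : 0 ≤ lam * ∑ j, |β j| := by positivity
  have h4 : 2 * p * ‖W‖ + S ≤ c * ‖d‖ := by
    have : c * R = c + (2 * p * ‖W‖ + S) := by rw [hR]; field_simp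
    nlinarith
  have h5 : S ≤ S * ‖d‖ := by nlinarith
  have h6 : (2 * p * ‖W‖ + S) * ‖d‖ ≤ c * ‖d‖ * ‖d‖ := by gcongr
  simp only [perturbedObjective, sub_self, zero_dotProduct, dotProduct_zero]
  rw [← hd', ← hS]
  nlinarith

lemma perturbedObjective_segment_le {p : ℕ} (G : Matrix (Fin p) (Fin p) ℝ) (βs W : Fin p → ℝ)
    {lam : ℝ} (hlam : 0 ≤ lam) (b β : Fin p → ℝ) {t : ℝ} (ht0 : 0 ≤ t) (ht1 : t ≤ 1) :
    perturbedObjective G βs W lam (b + t • (β - b)) ≤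
      (1 - t) * perturbedObjective G βs W lam b + t * perturbedObjective G βs W lam β
        - t * (1 - t) * ((β - b) ⬝ᵥ (G *ᵥ (β - b))) := by
  have habs : ∑ j, |(b + t • (β - b)) j| ≤ (1 - t) * ∑ j, |b j| + t * ∑ j, |β j| := by
    rw [Finset.mul_sum, Finset.mul_sum, ← Finset.sum_add_distrib]
    refine Finset.sum_le_sum fun j _ => ?_
    have : (b + t • (β - b)) j = (1 - t) * b j + t * β j := by
      simp only [Pi.add_apply, Pi.smul_apply, Pi.sub_apply, smul_eq_mul]; ring
    rw [this]
    refine (abs_add_le _ _).trans ?_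
    rw [abs_mul, abs_mul, abs_of_nonneg ht0, abs_of_nonneg (sub_nonneg.2 ht1)]
  have h1 : b + t • (β - b) - βs = (b - βs) + t • ((β - βs) - (b - βs)) := by
    abel_nf
  have h2 : (β - b) ⬝ᵥ (G *ᵥ (β - b)) =
      ((β - βs) - (b - βs)) ⬝ᵥ (G *ᵥ ((β - βs) - (b - βs))) := by
    rw [sub_sub_sub_cancel_right]
  have h3 := mul_le_mul_of_nonneg_left habs hlam
  unfold perturbedObjective
  rw [h1, h2]
  generalize β - βs = u at *
  generalize b - βs = v at *
  simp only [Matrix.mulVec_add, Matrix.mulVec_sub, Matrix.mulVec_smul, dotProduct_add,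
    dotProduct_sub, dotProduct_smul, add_dotProduct, sub_dotProduct, smul_dotProduct, smul_eq_mul]
  linarith

/-- Strong convexity along the segment from `b` to `β` gives `Δ ≥ (1 - t) q` for every small `t >
0`; letting `t` tend to `0` would give the full constant. -/
lemma IsPerturbedMinimizer.quad_le {p : ℕ} {G : Matrix (Fin p) (Fin p) ℝ} {βs W : Fin p → ℝ}
    {lam : ℝ} (hlam : 0 ≤ lam) {b : Fin p → ℝ} (hb : IsPerturbedMinimizer G βs W lam b)
    (β : Fin p → ℝ) :
    (β - b) ⬝ᵥ (G *ᵥ (β - b)) ≤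
      perturbedObjective G βs W lam β - perturbedObjective G βs W lam b := by
  set q := (β - b) ⬝ᵥ (G *ᵥ (β - b))
  set Δ := perturbedObjective G βs W lam β - perturbedObjective G βs W lam b with hΔ
  have hΔ0 : 0 ≤ Δ := sub_nonneg.2 (hb β)
  by_contra! hlt
  have hq : 0 < q := by linarith
  -- For this `t`, `(1 - t) q = (q + Δ) / 2`, which exceeds `Δ` when `Δ < q`.
  set t := (q - Δ) / (2 * q) with ht
  have ht0 : 0 < t := div_pos (by linarith) (by linarith)
  have ht1 : t ≤ 1 := by rw [ht, div_le_one (by linarith)]; linarith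
  have h1 := perturbedObjective_segment_le G βs W hlam b β ht0.le ht1
  have h2 := hb (b + t • (β - b))
  have h3 : 0 ≤ t * (Δ - (1 - t) * q) := by
    rw [hΔ]; linarith
  have h4 : 0 ≤ Δ - (1 - t) * q := nonneg_of_mul_nonneg_right h3 ht0
  have h5 : t * q = (q - Δ) / 2 := by rw [ht]; field_simp
  nlinarith

/-- Add the quadratic growth inequalities of the two minimizers, each tested at the other:
everything cancels except `2 (W₁ - W₂) ⬝ᵥ (b₁ - b₂)`. This yields uniqueness, measurability of the
lasso in the noise, and the tail bound. -/
lemma IsPerturbedMinimizer.norm_sub_le {p : ℕ} {G : Matrix (Fin p) (Fin p) ℝ} {c : ℝ} (hc : 0 < c)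
    (hG : QuadLowerBound c G) {βs W₁ W₂ : Fin p → ℝ} {lam : ℝ} (hlam : 0 ≤ lam)
    {b₁ b₂ : Fin p → ℝ} (h₁ : IsPerturbedMinimizer G βs W₁ lam b₁)
    (h₂ : IsPerturbedMinimizer G βs W₂ lam b₂) : ‖b₁ - b₂‖ ≤ p / c * ‖W₁ - W₂‖ := by
  have e₁ := h₁.quad_le hlam b₂
  have e₂ := h₂.quad_le hlam b₁
  have l₁ := hG (b₂ - b₁)
  have l₂ := hG (b₁ - b₂)
  rw [norm_sub_rev] at l₁
  have key : perturbedObjective G βs W₁ lam b₂ - perturbedObjective G βs W₁ lam b₁ +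
      (perturbedObjective G βs W₂ lam b₁ - perturbedObjective G βs W₂ lam b₂) =
      2 * ((W₁ - W₂) ⬝ᵥ (b₁ - b₂)) := by
    simp only [perturbedObjective, sub_dotProduct, dotProduct_sub]
    ring
  have h3 := (abs_le.1 (abs_dotProduct_le (W₁ - W₂) (b₁ - b₂))).2
  have h4 : c * ‖b₁ - b₂‖ ^ 2 ≤ p * (‖W₁ - W₂‖ * ‖b₁ - b₂‖) := by linarith
  rcases (norm_nonneg (b₁ - b₂)).eq_or_lt with h0 | h0
  · rw [← h0]; positivity
  · have h5 : c * ‖b₁ - b₂‖ ≤ p * ‖W₁ - W₂‖ := by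
      refine le_of_mul_le_mul_right ?_ h0
      linarith
    rw [div_mul_eq_mul_div, le_div_iff₀ hc]
    linarith

lemma IsPerturbedMinimizer.unique {p : ℕ} {G : Matrix (Fin p) (Fin p) ℝ} {c : ℝ} (hc : 0 < c)
    (hG : QuadLowerBound c G) {βs W : Fin p → ℝ} {lam : ℝ} (hlam : 0 ≤ lam)
    {b₁ b₂ : Fin p → ℝ} (h₁ : IsPerturbedMinimizer G βs W lam b₁)
    (h₂ : IsPerturbedMinimizer G βs W lam b₂) : b₁ = b₂ := by
  have := h₁.norm_sub_le hc hG hlam h₂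
  rw [sub_self, norm_zero, mul_zero] at this
  exact sub_eq_zero.1 (norm_le_zero_iff.1 this)

/-- Expanding about `b` leaves, beside the quadratic form, a sum separable over coordinates, so
optimality can be read off coordinate by coordinate. -/
lemma perturbedObjective_sub {p : ℕ} {G : Matrix (Fin p) (Fin p) ℝ} (hsymm : Gᵀ = G)
    (βs W : Fin p → ℝ) (lam : ℝ) (b β : Fin p → ℝ) :
    perturbedObjective G βs W lam β - perturbedObjective G βs W lam b =
      (β - b) ⬝ᵥ (G *ᵥ (β - b)) +
        ∑ j, (lam * (|β j| - |b j|) - 2 * (G *ᵥ (βs - b) + W) j * (β j - b j)) := by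
  have hs (u v : Fin p → ℝ) : u ⬝ᵥ (G *ᵥ v) = v ⬝ᵥ (G *ᵥ u) := by
    rw [Matrix.dotProduct_mulVec, ← Matrix.mulVec_transpose, hsymm, dotProduct_comm]
  have h1 : ∑ j, (lam * (|β j| - |b j|) - 2 * (G *ᵥ (βs - b) + W) j * (β j - b j)) =
      lam * ∑ j, |β j| - lam * ∑ j, |b j| - 2 * ((G *ᵥ (βs - b) + W) ⬝ᵥ (β - b)) := by
    simp only [dotProduct, Finset.mul_sum, ← Finset.sum_sub_distrib, Pi.sub_apply]
    refine Finset.sum_congr rfl fun j _ => by ring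
  rw [h1, dotProduct_comm _ (β - b)]
  have h2 : βs - b = -(b - βs) := by abel
  have h3 : β - b = (β - βs) - (b - βs) := by abel
  unfold perturbedObjective
  rw [h2, h3]
  generalize β - βs = u
  generalize b - βs = v
  have := hs u v
  have h4 := dotProduct_comm W u
  have h5 := dotProduct_comm W v
  simp only [Matrix.mulVec_sub, Matrix.mulVec_neg, dotProduct_add,
    dotProduct_sub, sub_dotProduct, dotProduct_neg]
  linarith

lemma isPerturbedMinimizer_of_subgradient {p : ℕ} {G : Matrix (Fin p) (Fin p) ℝ} {c : ℝ}
    (hc : 0 < c) (hG : QuadLowerBound c G) (hsymm : Gᵀ = G) {βs W : Fin p → ℝ} {lam : ℝ}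
    {b : Fin p → ℝ}
    (h : ∀ j t, 2 * (G *ᵥ (βs - b) + W) j * (t - b j) ≤ lam * (|t| - |b j|)) :
    IsPerturbedMinimizer G βs W lam b := by
  intro β
  rw [← sub_nonneg, perturbedObjective_sub hsymm]
  refine add_nonneg ((by positivity : (0 : ℝ) ≤ _).trans (hG _)) (Finset.sum_nonneg fun j _ => ?_)
  linarith [h j (β j)]

lemma IsPerturbedMinimizer.coordinate {p : ℕ} {G : Matrix (Fin p) (Fin p) ℝ} (hsymm : Gᵀ = G)
    {βs W : Fin p → ℝ} {lam : ℝ} {b : Fin p → ℝ} (hb : IsPerturbedMinimizer G βs W lam b)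
    (j : Fin p) (t : ℝ) :
    0 ≤ G j j * t ^ 2 + lam * (|b j + t| - |b j|) - 2 * (G *ᵥ (βs - b) + W) j * t := by
  have h := sub_nonneg.2 (hb (b + Pi.single j t))
  rw [perturbedObjective_sub hsymm, add_sub_cancel_left] at h
  have h1 : Pi.single j t ⬝ᵥ (G *ᵥ Pi.single j t) = G j j * t ^ 2 := by
    simp [Matrix.mulVec_single]
    ring
  have h2 : ∑ i, (lam * (|(b + Pi.single j t : Fin p → ℝ) i| - |b i|)
      - 2 * (G *ᵥ (βs - b) + W) i * ((b + Pi.single j t : Fin p → ℝ) i - b i)) =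
      lam * (|b j + t| - |b j|) - 2 * (G *ᵥ (βs - b) + W) j * t := by
    rw [Finset.sum_eq_single j]
    · simp
    · intro i _ hij
      simp [hij]
    · simp
  rw [h1, h2] at h
  linarith

lemma eq_zero_of_forall_small_quadratic_nonneg {a k r : ℝ} (hr : 0 < r)
    (h : ∀ t, |t| < r → 0 ≤ a * t ^ 2 + k * t) : k = 0 := by
  by_contra hk
  have hlim : Tendsto (fun t : ℝ => k * (a * t + k)) (𝓝 0) (𝓝 (k * k)) := by
    have : Continuous fun t : ℝ => k * (a * t + k) := by fun_prop
    simpa using this.tendsto 0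
  have hpos : ∀ᶠ t in 𝓝 (0 : ℝ), 0 < k * (a * t + k) :=
    hlim.eventually_const_lt (mul_self_pos.2 hk)
  obtain ⟨e, he, hball⟩ := Metric.eventually_nhds_iff.1 hpos
  set m := min e r / 2 with hm
  have hm0 : 0 < m := by positivity
  have hmin : 0 < min e r := lt_min he hr
  have hme : m < e := by linarith [min_le_left e r]
  have hmr : m < r := by linarith [min_le_right e r]
  rcases lt_or_gt_of_ne hk with hk | hk
  · have h1 := hball (y := m) (by simpa [abs_of_pos hm0] using hme)
    have h2 := h m (by simpa [abs_of_pos hm0] using hmr)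
    have h3 : a * m + k < 0 := by nlinarith
    nlinarith
  · have h1 := hball (y := -m) (by simpa [abs_of_pos hm0] using hme)
    have h2 := h (-m) (by simpa [abs_of_pos hm0] using hmr)
    have h3 : 0 < a * (-m) + k := by nlinarith
    nlinarith

lemma IsPerturbedMinimizer.gradient_eq {p : ℕ} {G : Matrix (Fin p) (Fin p) ℝ} (hsymm : Gᵀ = G)
    {βs W : Fin p → ℝ} {lam : ℝ} {b : Fin p → ℝ} (hb : IsPerturbedMinimizer G βs W lam b)
    {j : Fin p} (hj : b j ≠ 0) :
    2 * (G *ᵥ (βs - b) + W) j = lam * (SignType.sign (b j) : ℝ) := by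
  have h : lam * (SignType.sign (b j) : ℝ) - 2 * (G *ᵥ (βs - b) + W) j = 0 := by
    refine eq_zero_of_forall_small_quadratic_nonneg (a := G j j) (abs_pos.2 hj) fun t ht => ?_
    have := hb.coordinate hsymm j t
    rcases lt_or_gt_of_ne hj with h | h
    · rw [abs_of_neg h] at ht this
      rw [abs_of_neg (by linarith [(abs_lt.1 ht).2])] at this
      simp only [sign_neg h, SignType.coe_neg_one]
      linarith
    · rw [abs_of_pos h] at ht this
      rw [abs_of_pos (by linarith [(abs_lt.1 ht).1])] at this
      simp only [sign_pos h, SignType.coe_one]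
      linarith
  linarith

lemma IsPerturbedMinimizer.abs_gradient_le {p : ℕ} {G : Matrix (Fin p) (Fin p) ℝ}
    (hsymm : Gᵀ = G) {βs W : Fin p → ℝ} {lam : ℝ} {b : Fin p → ℝ}
    (hb : IsPerturbedMinimizer G βs W lam b) {j : Fin p} (hj : b j = 0) :
    |2 * (G *ᵥ (βs - b) + W) j| ≤ lam := by
  set g := 2 * (G *ᵥ (βs - b) + W) j with hg
  have hcoord (t : ℝ) : 0 ≤ G j j * t ^ 2 + lam * |t| - g * t := by
    have := hb.coordinate hsymm j t
    rwa [hj, zero_add, abs_zero, sub_zero, ← hg] at this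
  have hlin (k : ℝ) (h : ∀ t : ℝ, 0 < t → 0 ≤ G j j * t ^ 2 + k * t) : 0 ≤ k := by
    have hlim : Tendsto (fun t : ℝ => G j j * t + k) (𝓝[>] 0) (𝓝 k) := by
      have : Continuous fun t : ℝ => G j j * t + k := by fun_prop
      simpa using (this.tendsto 0).mono_left nhdsWithin_le_nhds
    refine ge_of_tendsto hlim ?_
    filter_upwards [self_mem_nhdsWithin] with t ht
    have ht' : (0 : ℝ) < t := ht
    refine nonneg_of_mul_nonneg_right (b := G j j * t + k) (a := t) ?_ ht'
    linarith [h t ht']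
  rw [abs_le]
  constructor
  · have := hlin (lam + g) fun t ht => by
      have := hcoord (-t)
      rw [abs_neg, abs_of_pos ht] at this
      linarith
    linarith
  · have := hlin (lam - g) fun t ht => by
      have := hcoord t
      rw [abs_of_pos ht] at this
      linarith
    linarith

/-! ### The explicit solution with prescribed support and signs -/

/-- The indicator vector of a set of indices. -/
noncomputable def supportIndicator {p : ℕ} (A : Finset (Fin p)) : Fin p → ℝ :=
  fun j => if j ∈ A then 1 else 0

/-- `G` restricted to the index set `A`, completed by the identity off `A`. -/
noncomputable def restrictedGram {p : ℕ} (A : Finset (Fin p)) (G : Matrix (Fin p) (Fin p) ℝ) :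
    Matrix (Fin p) (Fin p) ℝ :=
  Matrix.diagonal (supportIndicator A) * G * Matrix.diagonal (supportIndicator A) +
    (1 - Matrix.diagonal (supportIndicator A))

/-- The vector supported on `A` that solves `(G x)ⱼ = (G βs + W - (lam / 2) s)ⱼ` for `j ∈ A`. -/
noncomputable def restrictedSolution {p : ℕ} (A : Finset (Fin p)) (s : Fin p → ℝ) (βs : Fin p → ℝ)
    (G : Matrix (Fin p) (Fin p) ℝ) (W : Fin p → ℝ) (lam : ℝ) : Fin p → ℝ :=
  (restrictedGram A G)⁻¹ *ᵥ (supportIndicator A * (G *ᵥ βs + W - (lam / 2) • s))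

section restricted

variable {p : ℕ} {A : Finset (Fin p)} {G : Matrix (Fin p) (Fin p) ℝ} {c : ℝ}

lemma restrictedGram_mulVec (x : Fin p → ℝ) (j : Fin p) :
    (restrictedGram A G *ᵥ x) j = if j ∈ A then (G *ᵥ (supportIndicator A * x)) j else x j := by
  have h : Matrix.diagonal (supportIndicator A) *ᵥ x = supportIndicator A * x := by
    ext i
    simp [Matrix.mulVec_diagonal]
  rw [restrictedGram, Matrix.add_mulVec, Matrix.sub_mulVec, Matrix.one_mulVec, mul_assoc,
    ← Matrix.mulVec_mulVec, ← Matrix.mulVec_mulVec, h]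
  simp only [Pi.add_apply, Pi.sub_apply, Matrix.mulVec_diagonal, Pi.mul_apply]
  by_cases hj : j ∈ A <;> simp [supportIndicator, hj]

lemma supportIndicator_mul_eq_self {x : Fin p → ℝ} (hx : ∀ j ∉ A, x j = 0) :
    supportIndicator A * x = x := by
  ext j
  by_cases hj : j ∈ A <;> simp [supportIndicator, hj, hx]

/-- A kernel vector `v` vanishes off `A`, and `G *ᵥ v` vanishes on `A`, so `v ⬝ᵥ (G *ᵥ v) = 0`,
which coercivity forbids unless `v = 0`. -/
lemma isUnit_det_restrictedGram (hc : 0 < c) (hG : QuadLowerBound c G) (A : Finset (Fin p)) :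
    IsUnit (restrictedGram A G).det := by
  rw [isUnit_iff_ne_zero]
  intro hdet
  obtain ⟨v, hv, hMv⟩ := Matrix.exists_mulVec_eq_zero_iff.2 hdet
  have hrow (j : Fin p) := (restrictedGram_mulVec (A := A) (G := G) v j).symm.trans
    (congrFun hMv j)
  have hoff : ∀ j ∉ A, v j = 0 := fun j hj => by simpa [hj] using hrow j
  have hq : v ⬝ᵥ (G *ᵥ v) = 0 := by
    refine Finset.sum_eq_zero fun j _ => ?_
    by_cases hj : j ∈ A
    · have := hrow j
      rw [if_pos hj, supportIndicator_mul_eq_self hoff, Pi.zero_apply] at this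
      rw [this, mul_zero]
    · rw [hoff j hj, zero_mul]
  have h := hG v
  rw [hq] at h
  have hpos : 0 < c * ‖v‖ ^ 2 := by
    have := norm_pos_iff.2 hv
    positivity
  linarith

lemma eq_restrictedSolution_iff (hc : 0 < c) (hG : QuadLowerBound c G)
    {s βs W x : Fin p → ℝ} {lam : ℝ} :
    x = restrictedSolution A s βs G W lam ↔
      (∀ j ∉ A, x j = 0) ∧ ∀ j ∈ A, (G *ᵥ x) j = (G *ᵥ βs) j + W j - lam / 2 * s j := by
  have hu := isUnit_det_restrictedGram hc hG A
  have h1 : x = restrictedSolution A s βs G W lam ↔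
      restrictedGram A G *ᵥ x = supportIndicator A * (G *ᵥ βs + W - (lam / 2) • s) := by
    constructor
    · rintro rfl
      rw [restrictedSolution, Matrix.mulVec_mulVec, Matrix.mul_nonsing_inv _ hu,
        Matrix.one_mulVec]
    · intro h
      rw [restrictedSolution, ← h, Matrix.mulVec_mulVec, Matrix.nonsing_inv_mul _ hu,
        Matrix.one_mulVec]
  rw [h1, funext_iff]
  constructor
  · intro h
    have hoff : ∀ j ∉ A, x j = 0 := fun j hj => by
      have := h j
      rw [restrictedGram_mulVec] at this
      simpa [hj, supportIndicator] using this
    refine ⟨hoff, fun j hj => ?_⟩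
    have := h j
    rw [restrictedGram_mulVec, if_pos hj, supportIndicator_mul_eq_self hoff] at this
    simpa [hj, supportIndicator] using this
  · rintro ⟨hoff, hon⟩ j
    rw [restrictedGram_mulVec, supportIndicator_mul_eq_self hoff]
    by_cases hj : j ∈ A
    · simp [hj, hon, supportIndicator]
    · simp [hj, hoff, supportIndicator]

/-- Affineness in the noise score turns the expected inner product with `W` into a covariance trace.
-/
lemma restrictedSolution_eq_add (s βs W : Fin p → ℝ) (lam : ℝ) :
    restrictedSolution A s βs G W lam = restrictedSolution A s βs G 0 lam +
      ((restrictedGram A G)⁻¹ * Matrix.diagonal (supportIndicator A)) *ᵥ W := by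
  have h : Matrix.diagonal (supportIndicator A) *ᵥ W = supportIndicator A * W := by
    ext i
    simp [Matrix.mulVec_diagonal]
  rw [restrictedSolution, restrictedSolution, ← Matrix.mulVec_mulVec, h, ← Matrix.mulVec_add,
    ← mul_add]
  congr 2
  abel

lemma norm_restrictedSolution_sub_le (hc : 0 < c) (hG : QuadLowerBound c G)
    (s βs W₁ W₂ : Fin p → ℝ) (lam : ℝ) :
    ‖restrictedSolution A s βs G W₁ lam - restrictedSolution A s βs G W₂ lam‖ ≤
      p / c * ‖W₁ - W₂‖ := by
  obtain ⟨hoff₁, hon₁⟩ := (eq_restrictedSolution_iff hc hG).1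
    (Eq.refl (restrictedSolution A s βs G W₁ lam))
  obtain ⟨hoff₂, hon₂⟩ := (eq_restrictedSolution_iff hc hG).1
    (Eq.refl (restrictedSolution A s βs G W₂ lam))
  set b₁ := restrictedSolution A s βs G W₁ lam
  set b₂ := restrictedSolution A s βs G W₂ lam
  have hq : (b₁ - b₂) ⬝ᵥ (G *ᵥ (b₁ - b₂)) = (W₁ - W₂) ⬝ᵥ (b₁ - b₂) := by
    refine Finset.sum_congr rfl fun j _ => ?_
    by_cases hj : j ∈ A
    · rw [Matrix.mulVec_sub, Pi.sub_apply (G *ᵥ b₁), hon₁ j hj, hon₂ j hj, Pi.sub_apply W₁]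
      ring
    · simp [hoff₁ j hj, hoff₂ j hj]
  have h1 := hG (b₁ - b₂)
  have h3 := (abs_le.1 (abs_dotProduct_le (W₁ - W₂) (b₁ - b₂))).2
  have h4 : c * ‖b₁ - b₂‖ ^ 2 ≤ p * (‖W₁ - W₂‖ * ‖b₁ - b₂‖) := by linarith
  rcases (norm_nonneg (b₁ - b₂)).eq_or_lt with h0 | h0
  · rw [← h0]; positivity
  · have h5 : c * ‖b₁ - b₂‖ ≤ p * ‖W₁ - W₂‖ := by
      refine le_of_mul_le_mul_right ?_ h0
      linarith
    rw [div_mul_eq_mul_div, le_div_iff₀ hc]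
    linarith

/-- With `M` the restricted Gram matrix and `D` the diagonal projection onto `A`, `M` commutes with
`D` and `D G D = M D`. Cyclicity reduces the trace to that of `D`. This is where the size of the
active set enters the degrees of freedom. -/
lemma trace_restrictedGram_inv_mul (hc : 0 < c) (hG : QuadLowerBound c G) :
    ((restrictedGram A G)⁻¹ * Matrix.diagonal (supportIndicator A) * G).trace = A.card := by
  have hu := isUnit_det_restrictedGram hc hG A
  have hDD : Matrix.diagonal (supportIndicator A) * Matrix.diagonal (supportIndicator A) =
      Matrix.diagonal (supportIndicator A) := by
    rw [Matrix.diagonal_mul_diagonal]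
    congr 1
    ext j
    by_cases hj : j ∈ A <;> simp [supportIndicator, hj]
  have htr : (Matrix.diagonal (supportIndicator A)).trace = A.card := by
    simp [Matrix.trace_diagonal, supportIndicator]
  have hMdef : restrictedGram A G =
    Matrix.diagonal (supportIndicator A) * G * Matrix.diagonal (supportIndicator A) +
    (1 - Matrix.diagonal (supportIndicator A)) := rfl
  generalize restrictedGram A G = M at *
  generalize Matrix.diagonal (supportIndicator A) = D at *
  have hDM : D * M = D * G * D := by
    rw [hMdef, mul_add, mul_sub, mul_one, hDD, sub_self, add_zero, ← mul_assoc, ← mul_assoc, hDD]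
  have hMD : M * D = D * G * D := by
    rw [hMdef, add_mul, sub_mul, one_mul, hDD, sub_self, add_zero, mul_assoc _ D D, hDD]
  have hcomm : M⁻¹ * D = D * M⁻¹ := by
    calc M⁻¹ * D = M⁻¹ * (D * M) * M⁻¹ := by
          rw [mul_assoc, mul_assoc, Matrix.mul_nonsing_inv _ hu, mul_one]
      _ = D * M⁻¹ := by
          rw [hDM, ← hMD, ← mul_assoc, Matrix.nonsing_inv_mul _ hu, one_mul]
  calc (M⁻¹ * D * G).trace = (D * (M⁻¹ * D * G)).trace := by
        rw [← mul_assoc, ← mul_assoc, ← hcomm, mul_assoc _ D D, hDD]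
    _ = (M⁻¹ * (D * G * D)).trace := by
        rw [Matrix.trace_mul_comm]; simp only [mul_assoc]
    _ = D.trace := by
        rw [← hMD, ← mul_assoc, Matrix.nonsing_inv_mul _ hu, one_mul]
    _ = A.card := htr

lemma continuousAt_restrictedSolution (hc : 0 < c) (hG : QuadLowerBound c G)
    (A : Finset (Fin p)) (s βs W : Fin p → ℝ) (lam : ℝ) :
    ContinuousAt (fun x : (Matrix (Fin p) (Fin p) ℝ × ℝ) × (Fin p → ℝ) =>
      restrictedSolution A s βs x.1.1 x.2 x.1.2) ((G, lam), W) := by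
  have hM : Continuous fun x : (Matrix (Fin p) (Fin p) ℝ × ℝ) × (Fin p → ℝ) =>
      restrictedGram A x.1.1 := by
    unfold restrictedGram
    fun_prop
  have hinv : ContinuousAt (fun x : (Matrix (Fin p) (Fin p) ℝ × ℝ) × (Fin p → ℝ) =>
      (restrictedGram A x.1.1)⁻¹) ((G, lam), W) := by
    simp only [Matrix.inv_def, Ring.inverse_eq_inv']
    refine ContinuousAt.smul (ContinuousAt.inv₀ hM.matrix_det.continuousAt ?_)
      hM.matrix_adjugate.continuousAt
    exact (isUnit_det_restrictedGram hc hG A).ne_zero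
  have hr : Continuous fun x : (Matrix (Fin p) (Fin p) ℝ × ℝ) × (Fin p → ℝ) =>
      supportIndicator A * (x.1.1 *ᵥ βs + x.2 - (x.1.2 / 2) • s) := by
    fun_prop
  have hmul : Continuous fun y : Matrix (Fin p) (Fin p) ℝ × (Fin p → ℝ) => y.1 *ᵥ y.2 := by
    fun_prop
  exact hmul.continuousAt.comp (hinv.prodMk hr.continuousAt)

end restricted

/-! ### The limiting problem: strict optimality bounds at `lamStar` -/

lemma limitObjective_eq_perturbedObjective {p : ℕ} (C : Matrix (Fin p) (Fin p) ℝ)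
    (βs : Fin p → ℝ) (lam : ℝ) : limitObjective C βs lam = perturbedObjective C βs 0 lam := by
  ext β
  simp [limitObjective, perturbedObjective]

lemma isPerturbedMinimizer_limitCoef {p : ℕ} {C : Matrix (Fin p) (Fin p) ℝ} (hC : C.PosDef)
    (βs : Fin p → ℝ) {lam : ℝ} (hlam : 0 ≤ lam) :
    IsPerturbedMinimizer C βs 0 lam (limitCoef C βs lam) := by
  obtain ⟨c, hc, hq⟩ := quadLowerBound_of_posDef hC
  have h := Classical.epsilon_spec (exists_isPerturbedMinimizer hc hq βs 0 hlam)
  rw [limitCoef, limitObjective_eq_perturbedObjective]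
  exact h

/-- The sign vector with real entries. -/
noncomputable def realSign {p : ℕ} (b : Fin p → ℝ) : Fin p → ℝ :=
  fun j => (SignType.sign (b j) : ℝ)

lemma mem_activeSet {p : ℕ} {b : Fin p → ℝ} {j : Fin p} : j ∈ activeSet b ↔ b j ≠ 0 := by
  simp [activeSet]

lemma eq_restrictedSolution_of_isPerturbedMinimizer {p : ℕ} {G : Matrix (Fin p) (Fin p) ℝ}
    {c : ℝ} (hc : 0 < c) (hG : QuadLowerBound c G) (hsymm : Gᵀ = G) {βs W b : Fin p → ℝ} {lam : ℝ}
    (hb : IsPerturbedMinimizer G βs W lam b) :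
    b = restrictedSolution (activeSet b) (realSign b) βs G W lam := by
  rw [eq_restrictedSolution_iff hc hG]
  refine ⟨fun j hj => by simpa [mem_activeSet] using hj, fun j hj => ?_⟩
  have h := hb.gradient_eq hsymm (mem_activeSet.1 hj)
  rw [Matrix.mulVec_sub] at h
  simp only [Pi.add_apply, Pi.sub_apply] at h
  simp only [realSign]
  linarith

lemma eventually_limitCoef_eq_restrictedSolution {p : ℕ} {C : Matrix (Fin p) (Fin p) ℝ}
    (hC : C.PosDef) (βs : Fin p → ℝ) {lamStar : ℝ} (hlamStar : 0 < lamStar)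
    (h : ¬ IsTransitionPoint (limitCoef C βs) lamStar) :
    ∀ᶠ l in 𝓝 lamStar, limitCoef C βs l =
      restrictedSolution (activeSet (limitCoef C βs lamStar)) (realSign (limitCoef C βs lamStar))
        βs C 0 l := by
  obtain ⟨c, hc, hq⟩ := quadLowerBound_of_posDef hC
  have hsymm : Cᵀ = C := by simpa using hC.isHermitian.eq
  simp only [IsTransitionPoint, not_or, not_and, not_not] at h
  filter_upwards [h.2 hlamStar, eventually_gt_nhds hlamStar] with l hl hl0
  have h1 := eq_restrictedSolution_of_isPerturbedMinimizer hc hq hsymm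
    (isPerturbedMinimizer_limitCoef hC βs hl0.le)
  have h2 : realSign (limitCoef C βs l) = realSign (limitCoef C βs lamStar) := by
    ext j
    have := congrFun hl.2 j
    simp only [signVector] at this
    simp only [realSign, this]
  rwa [hl.1, h2] at h1

lemma exists_restrictedSolution_eq_affine {p : ℕ} (A : Finset (Fin p)) (s βs : Fin p → ℝ)
    (G : Matrix (Fin p) (Fin p) ℝ) (W : Fin p → ℝ) :
    ∃ u v : Fin p → ℝ, ∀ l, restrictedSolution A s βs G W l = u + l • v := by
  refine ⟨(restrictedGram A G)⁻¹ *ᵥ (supportIndicator A * (G *ᵥ βs + W)),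
    (restrictedGram A G)⁻¹ *ᵥ (supportIndicator A * (-(1 / 2 : ℝ) • s)), fun l => ?_⟩
  rw [restrictedSolution, ← Matrix.mulVec_smul, ← Matrix.mulVec_add]
  congr 1
  ext j
  simp only [Pi.mul_apply, Pi.add_apply, Pi.sub_apply, Pi.smul_apply, smul_eq_mul]
  ring

/-- An affine function with an interior local maximum has slope zero. -/
lemma affine_eq_zero_of_eventually_nonpos {a k l₀ : ℝ} (h : ∀ᶠ l in 𝓝 l₀, a + l * k ≤ 0)
    (h₀ : a + l₀ * k = 0) (l : ℝ) : a + l * k = 0 := by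
  obtain ⟨r, hr, hball⟩ := Metric.eventually_nhds_iff.1 h
  have hk : -k = 0 := by
    refine eq_zero_of_forall_small_quadratic_nonneg (a := 0) hr fun t ht => ?_
    have := hball (y := l₀ + t) (by simpa [dist_eq_norm] using ht)
    linarith
  have hk' : k = 0 := by linarith
  subst hk'
  linarith

/-- Off transition points the path is locally affine in `l`, hence so is each gradient coordinate
`g`. If the bound were attained at `lamStar`, one of the affine functions `g - l`, `-g - l`,
nonpositive nearby, would vanish there and so identically. The bound would then hold with equality
on a neighbourhood, which is degeneracy. -/
lemma abs_gradient_lt_of_not_isDegenerateAt {p : ℕ} {C : Matrix (Fin p) (Fin p) ℝ}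
    (hC : C.PosDef) (βs : Fin p → ℝ) {lamStar : ℝ} (hlamStar : 0 < lamStar)
    (h : ¬ IsTransitionPoint (limitCoef C βs) lamStar) {j : Fin p}
    (hnd : ¬ IsDegenerateAt C βs lamStar j) (hj : limitCoef C βs lamStar j = 0) :
    |2 * (C *ᵥ (βs - limitCoef C βs lamStar)) j| < lamStar := by
  have hsymm : Cᵀ = C := by simpa using hC.isHermitian.eq
  have hsol := eventually_limitCoef_eq_restrictedSolution hC βs hlamStar h
  obtain ⟨u, v, huv⟩ := exists_restrictedSolution_eq_affine
    (activeSet (limitCoef C βs lamStar)) (realSign (limitCoef C βs lamStar)) βs C 0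
  simp only [huv] at hsol
  have hzero : ∀ᶠ l in 𝓝 lamStar, limitCoef C βs l j = 0 := by
    simp only [IsTransitionPoint, not_or, not_and, not_not] at h
    filter_upwards [h.2 hlamStar] with l hl
    have : j ∉ activeSet (limitCoef C βs l) := by
      rw [hl.1, mem_activeSet]; simpa using hj
    simpa [mem_activeSet] using this
  set a := 2 * (C *ᵥ (βs - u)) j with ha
  set k := -(2 * (C *ᵥ v) j) with hk
  have hgrad : ∀ᶠ l in 𝓝 lamStar, 2 * (C *ᵥ (βs - limitCoef C βs l)) j = a + l * k := by
    filter_upwards [hsol] with l hl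
    rw [hl, ← sub_sub, Matrix.mulVec_sub, Matrix.mulVec_smul, ha, hk]
    simp only [Pi.sub_apply, Pi.smul_apply, smul_eq_mul]
    ring
  have hle : ∀ᶠ l in 𝓝 lamStar, |a + l * k| ≤ l := by
    filter_upwards [hgrad, hzero, eventually_gt_nhds hlamStar] with l hl hz hl0
    have := (isPerturbedMinimizer_limitCoef hC βs hl0.le).abs_gradient_le hsymm hz
    rwa [add_zero, hl] at this
  rw [hgrad.self_of_nhds]
  refine lt_of_le_of_ne hle.self_of_nhds fun heq => hnd ?_
  have hattain : ∀ᶠ l in 𝓝 lamStar, |a + l * k| = l := by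
    rcases abs_choice (a + lamStar * k) with hs | hs
    · have hall := affine_eq_zero_of_eventually_nonpos (a := a) (k := k - 1) (l₀ := lamStar)
        (by filter_upwards [hle] with l hl; linarith [le_abs_self (a + l * k)])
        (by linarith)
      filter_upwards [eventually_gt_nhds hlamStar] with l hl
      rw [show a + l * k = l by linarith [hall l], abs_of_pos hl]
    · have hall := affine_eq_zero_of_eventually_nonpos (a := -a) (k := -k - 1) (l₀ := lamStar)
        (by filter_upwards [hle] with l hl; linarith [neg_abs_le (a + l * k)])
        (by linarith)
      filter_upwards [eventually_gt_nhds hlamStar] with l hl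
      rw [show a + l * k = -l by linarith [hall l], abs_neg, abs_of_pos hl]
  filter_upwards [hzero, hgrad, hattain] with l h1 h2 h3
  refine ⟨h1, ?_⟩
  rwa [← h2, abs_mul, abs_two] at h3

/-! ### Local constancy of the active set -/

/-- Near a nondegenerate problem the restricted solution is the minimizer, and the active set is
locally constant. -/
lemma exists_eventually_isPerturbedMinimizer_restrictedSolution {p : ℕ}
    {C : Matrix (Fin p) (Fin p) ℝ} (hC : C.PosDef) {βs b : Fin p → ℝ} {lamStar : ℝ}
    (hlamStar : 0 < lamStar) (hb : IsPerturbedMinimizer C βs 0 lamStar b)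
    (hstrict : ∀ j, b j = 0 → |2 * (C *ᵥ (βs - b)) j| < lamStar) :
    ∃ δ > 0, ∀ᶠ x : Matrix (Fin p) (Fin p) ℝ × ℝ in 𝓝 (C, lamStar), x.1ᵀ = x.1 →
      ∀ W : Fin p → ℝ, ‖W‖ < δ →
      IsPerturbedMinimizer x.1 βs W x.2
        (restrictedSolution (activeSet b) (realSign b) βs x.1 W x.2) ∧
      activeSet (restrictedSolution (activeSet b) (realSign b) βs x.1 W x.2) = activeSet b := by
  have hsymm : Cᵀ = C := by simpa using hC.isHermitian.eq
  obtain ⟨c, hc, hq⟩ := eventually_quadLowerBound hC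
  have hqC := hq.self_of_nhds
  set A := activeSet b with hA
  set s := realSign b with hs
  have hb0 : restrictedSolution A s βs C 0 lamStar = b :=
    (eq_restrictedSolution_of_isPerturbedMinimizer hc hqC hsymm hb).symm
  have hcont := continuousAt_restrictedSolution hc hqC A s βs 0 lamStar
  have hfst : ContinuousAt (fun x : (Matrix (Fin p) (Fin p) ℝ × ℝ) × (Fin p → ℝ) => x.1.1)
      ((C, lamStar), 0) := by fun_prop
  have hsign : ∀ᶠ x : (Matrix (Fin p) (Fin p) ℝ × ℝ) × (Fin p → ℝ) in 𝓝 ((C, lamStar), 0),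
      ∀ j ∈ A, 0 < s j * restrictedSolution A s βs x.1.1 x.2 x.1.2 j := by
    rw [Filter.eventually_all_finset]
    intro j hj
    have h1 : ContinuousAt (fun x : (Matrix (Fin p) (Fin p) ℝ × ℝ) × (Fin p → ℝ) =>
        s j * restrictedSolution A s βs x.1.1 x.2 x.1.2 j) ((C, lamStar), 0) :=
      continuousAt_const.mul ((continuous_apply j).continuousAt.comp hcont)
    refine continuousAt_const.eventually_lt h1 ?_
    change 0 < s j * restrictedSolution A s βs C 0 lamStar j
    rw [hb0, hs, realSign, sign_mul_self]
    exact abs_pos.2 (mem_activeSet.1 hj)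
  have hdual : ∀ᶠ x : (Matrix (Fin p) (Fin p) ℝ × ℝ) × (Fin p → ℝ) in 𝓝 ((C, lamStar), 0),
      ∀ j ∈ Aᶜ, |2 * (x.1.1 *ᵥ (βs - restrictedSolution A s βs x.1.1 x.2 x.1.2) + x.2) j| <
        x.1.2 := by
    rw [Filter.eventually_all_finset]
    intro j hj
    have hmul : Continuous fun y : Matrix (Fin p) (Fin p) ℝ × (Fin p → ℝ) => y.1 *ᵥ y.2 := by
      fun_prop
    have h0 := hmul.continuousAt.comp (hfst.prodMk (continuousAt_const (y := βs) |>.sub hcont))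
    have h1 : ContinuousAt (fun x : (Matrix (Fin p) (Fin p) ℝ × ℝ) × (Fin p → ℝ) =>
        |2 * (x.1.1 *ᵥ (βs - restrictedSolution A s βs x.1.1 x.2 x.1.2) + x.2) j|)
        ((C, lamStar), 0) :=
      (continuousAt_const.mul ((continuous_apply j).continuousAt.comp
        (h0.add continuousAt_snd))).abs
    refine h1.eventually_lt (by fun_prop) ?_
    simp only [hb0, add_zero]
    exact hstrict j (by simpa [hA, mem_activeSet] using hj)
  have hqx : ∀ᶠ x : (Matrix (Fin p) (Fin p) ℝ × ℝ) × (Fin p → ℝ) in 𝓝 ((C, lamStar), 0),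
      QuadLowerBound c x.1.1 := hfst.eventually hq
  have hpos : ∀ᶠ x : (Matrix (Fin p) (Fin p) ℝ × ℝ) × (Fin p → ℝ) in 𝓝 ((C, lamStar), 0),
      0 < x.1.2 := by
    refine ContinuousAt.eventually_lt continuousAt_const (by fun_prop) ?_
    exact hlamStar
  have hall := hsign.and (hdual.and (hqx.and hpos))
  -- Splitting into a product neighbourhood makes `δ` independent of the Gram matrix and the
  -- penalty, hence of `n`.
  rw [nhds_prod_eq, eventually_prod_iff] at hall
  obtain ⟨pa, hpa, pb, hpb, hab⟩ := hall
  obtain ⟨δ, hδ, hball⟩ := Metric.eventually_nhds_iff.1 hpb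
  refine ⟨δ, hδ, ?_⟩
  filter_upwards [hpa] with x hx hsx W hW
  obtain ⟨h1, h2, h3, h4⟩ := hab hx (hball (y := W) (by simpa using hW))
  dsimp only at h1 h2 h3 h4
  obtain ⟨hoff, hon⟩ := (eq_restrictedSolution_iff hc h3).1
    (Eq.refl (restrictedSolution A s βs x.1 W x.2))
  set r := restrictedSolution A s βs x.1 W x.2
  refine ⟨isPerturbedMinimizer_of_subgradient hc h3 hsx fun j t => ?_, ?_⟩
  · by_cases hj : j ∈ A
    · have hg : 2 * (x.1 *ᵥ (βs - r) + W) j = x.2 * s j := by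
        rw [Matrix.mulVec_sub]
        simp only [Pi.add_apply, Pi.sub_apply]
        rw [hon j hj]
        ring
      rw [hg, mul_assoc]
      refine mul_le_mul_of_nonneg_left ?_ h4.le
      have hpos := h1 j hj
      rcases lt_or_gt_of_ne (mem_activeSet.1 hj) with hneg | hneg
      · have hsj : s j = -1 := by simp [hs, realSign, hneg]
        rw [hsj] at hpos ⊢
        rw [abs_of_neg (a := r j) (by linarith)]
        linarith [neg_abs_le t]
      · have hsj : s j = 1 := by simp [hs, realSign, hneg]
        rw [hsj] at hpos ⊢
        rw [abs_of_pos (a := r j) (by linarith)]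
        linarith [le_abs_self t]
    · rw [hoff j hj, sub_zero, abs_zero, sub_zero]
      refine (le_abs_self _).trans ?_
      rw [abs_mul]
      exact mul_le_mul_of_nonneg_right (h2 j (by simpa using hj)).le (abs_nonneg _)
  · ext j
    rw [mem_activeSet]
    refine ⟨fun h => by_contra fun hj => h (hoff j hj), fun hj h => ?_⟩
    have := h1 j hj
    rw [h, mul_zero] at this
    exact lt_irrefl _ this

/-! ### Reduction of the lasso to the perturbed criterion -/

/-- The normalized Gram matrix `XᵀX / n`. -/
noncomputable def normalizedGram {n p : ℕ} (X : Matrix (Fin n) (Fin p) ℝ) :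
    Matrix (Fin p) (Fin p) ℝ :=
  (1 / (n : ℝ)) • (Xᵀ * X)

/-- The normalized noise score `Xᵀ e / n`. -/
noncomputable def noiseScore {n p : ℕ} (X : Matrix (Fin n) (Fin p) ℝ) (e : Fin n → ℝ) :
    Fin p → ℝ :=
  (1 / (n : ℝ)) • (Xᵀ *ᵥ e)

lemma normalizedGram_transpose {n p : ℕ} (X : Matrix (Fin n) (Fin p) ℝ) :
    (normalizedGram X)ᵀ = normalizedGram X := by
  simp [normalizedGram, Matrix.transpose_smul, Matrix.transpose_mul]

lemma natCast_mul_dotProduct_noiseScore {n p : ℕ} (hn : n ≠ 0) (X : Matrix (Fin n) (Fin p) ℝ)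
    (e : Fin n → ℝ) (v : Fin p → ℝ) : n * (v ⬝ᵥ noiseScore X e) = (X *ᵥ v) ⬝ᵥ e := by
  have hn' : (n : ℝ) ≠ 0 := Nat.cast_ne_zero.2 hn
  rw [noiseScore, dotProduct_smul, smul_eq_mul, Matrix.dotProduct_mulVec, Matrix.vecMul_transpose]
  field_simp

/-- Substitute `y - Xβ = e - X(β - βs)` and expand the square. The term `e ⬝ᵥ e` does not involve
`β`, so the minimizers are the same. -/
lemma lassoObjective_eq {n p : ℕ} (hn : n ≠ 0) (X : Matrix (Fin n) (Fin p) ℝ)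
    {y e : Fin n → ℝ} {βs : Fin p → ℝ} (hy : ∀ i, y i = (X *ᵥ βs) i + e i) (lam : ℝ)
    (β : Fin p → ℝ) :
    lassoObjective X y lam β =
      n * perturbedObjective (normalizedGram X) βs (noiseScore X e) (lam / n) β + e ⬝ᵥ e := by
  have hn' : (n : ℝ) ≠ 0 := Nat.cast_ne_zero.2 hn
  have h1 := natCast_mul_dotProduct_noiseScore hn X e (β - βs)
  have h2 : n * ((β - βs) ⬝ᵥ (normalizedGram X *ᵥ (β - βs))) =
      (X *ᵥ (β - βs)) ⬝ᵥ (X *ᵥ (β - βs)) := by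
    rw [normalizedGram, Matrix.smul_mulVec, dotProduct_smul, ← Matrix.mulVec_mulVec,
      Matrix.dotProduct_mulVec _ Xᵀ, Matrix.vecMul_transpose, smul_eq_mul]
    field_simp
  have h3 : ∑ i, (y i - (X *ᵥ β) i) ^ 2 = e ⬝ᵥ e - 2 * ((X *ᵥ (β - βs)) ⬝ᵥ e) +
      (X *ᵥ (β - βs)) ⬝ᵥ (X *ᵥ (β - βs)) := by
    simp only [dotProduct, Finset.mul_sum, ← Finset.sum_sub_distrib, ← Finset.sum_add_distrib,
      Matrix.mulVec_sub, Pi.sub_apply, hy]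
    exact Finset.sum_congr rfl fun i _ => by ring
  rw [lassoObjective, h3, perturbedObjective, mul_add, mul_sub, h2, ← h1,
    dotProduct_comm (noiseScore X e)]
  field_simp
  ring

lemma isPerturbedMinimizer_lassoCoef {n p : ℕ} (hn : n ≠ 0) {X : Matrix (Fin n) (Fin p) ℝ}
    {c : ℝ} (hc : 0 < c) (hX : QuadLowerBound c (normalizedGram X))
    {y e : Fin n → ℝ} {βs : Fin p → ℝ} (hy : ∀ i, y i = (X *ᵥ βs) i + e i) {lam : ℝ}
    (hlam : 0 ≤ lam / n) :
    IsPerturbedMinimizer (normalizedGram X) βs (noiseScore X e) (lam / n) (lassoCoef X y lam) := by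
  have hn' : (0 : ℝ) < n := Nat.cast_pos.2 (Nat.pos_of_ne_zero hn)
  have hiff (b : Fin p → ℝ) : (∀ β, lassoObjective X y lam b ≤ lassoObjective X y lam β) ↔
      IsPerturbedMinimizer (normalizedGram X) βs (noiseScore X e) (lam / n) b := by
    simp only [lassoObjective_eq hn X hy, add_le_add_iff_right, mul_le_mul_iff_right₀ hn']
    rfl
  obtain ⟨b, hb⟩ := exists_isPerturbedMinimizer hc hX βs (noiseScore X e) hlam
  exact (hiff _).1 (Classical.epsilon_spec (p := fun b =>
    ∀ β, lassoObjective X y lam b ≤ lassoObjective X y lam β) ⟨b, (hiff b).2 hb⟩)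

/-! ### Moments of the Gaussian noise score -/

section noise

variable {Ω : Type*} [MeasurableSpace Ω] {P : Measure Ω}
  {n p : ℕ} {v : ℝ≥0} {e : Fin n → Ω → ℝ}

lemma integral_eq_zero_of_hasLaw {f : Ω → ℝ} (hf : HasLaw f (gaussianReal 0 v) P) :
    ∫ ω, f ω ∂P = 0 := by
  rw [hf.integral_eq, integral_id_gaussianReal]

lemma hasGaussianLaw_noiseScore (hind : iIndepFun e P)
    (hlaw : ∀ i, HasLaw (e i) (gaussianReal 0 v) P) (X : Matrix (Fin n) (Fin p) ℝ) :
    HasGaussianLaw (fun ω => noiseScore X fun i => e i ω) P := by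
  have h := hind.hasGaussianLaw fun i => (hlaw i).hasGaussianLaw
  exact h.map_fun (((1 / (n : ℝ)) • Matrix.mulVecLin Xᵀ).toContinuousLinearMap)

lemma integral_mul_of_iIndepFun_gaussian [IsProbabilityMeasure P] (hind : iIndepFun e P)
    (hlaw : ∀ i, HasLaw (e i) (gaussianReal 0 v) P) (i k : Fin n) :
    ∫ ω, e i ω * e k ω ∂P = if i = k then (v : ℝ) else 0 := by
  have hm (i : Fin n) : MemLp (e i) 2 P := (hlaw i).hasGaussianLaw.memLp_two
  have h := covariance_eq_sub (hm i) (hm k)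
  rw [integral_eq_zero_of_hasLaw (hlaw i), zero_mul, sub_zero] at h
  have h' : ∫ ω, e i ω * e k ω ∂P = covariance (e i) (e k) P := h.symm
  rw [h']
  split_ifs with hik
  · subst hik
    rw [covariance_self (hlaw i).aemeasurable, (hlaw i).variance_eq, variance_id_gaussianReal]
  · exact (hind.indepFun hik).covariance_eq_zero (hm i) (hm k)

lemma noiseScore_apply (X : Matrix (Fin n) (Fin p) ℝ) (u : Fin n → ℝ) (j : Fin p) :
    noiseScore X u j = ∑ i, (1 / (n : ℝ) * X i j) * u i := by
  simp [noiseScore, Matrix.mulVec, dotProduct, Finset.mul_sum, mul_assoc]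

lemma integral_noiseScore (hlaw : ∀ i, HasLaw (e i) (gaussianReal 0 v) P)
    (X : Matrix (Fin n) (Fin p) ℝ) (j : Fin p) :
    ∫ ω, noiseScore X (fun i => e i ω) j ∂P = 0 := by
  simp only [noiseScore_apply]
  rw [integral_finsetSum _ fun i _ => (hlaw i).hasGaussianLaw.integrable.const_mul _]
  simp [integral_const_mul, integral_eq_zero_of_hasLaw (hlaw _)]

lemma integral_noiseScore_mul [IsProbabilityMeasure P] (hind : iIndepFun e P)
    (hlaw : ∀ i, HasLaw (e i) (gaussianReal 0 v) P) (X : Matrix (Fin n) (Fin p) ℝ)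
    (j k : Fin p) :
    ∫ ω, noiseScore X (fun i => e i ω) j * noiseScore X (fun i => e i ω) k ∂P =
      v / n * normalizedGram X j k := by
  have hm (i : Fin n) : MemLp (e i) 2 P := (hlaw i).hasGaussianLaw.memLp_two
  have hint (i l : Fin n) : Integrable (fun ω => (1 / (n : ℝ) * X i j) * (1 / (n : ℝ) * X l k) *
      (e i ω * e l ω)) P := ((hm i).integrable_mul (hm l)).const_mul _
  have hexp (ω : Ω) : noiseScore X (fun i => e i ω) j * noiseScore X (fun i => e i ω) k =
      ∑ i, ∑ l, (1 / (n : ℝ) * X i j) * (1 / (n : ℝ) * X l k) * (e i ω * e l ω) := by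
    rw [noiseScore_apply, noiseScore_apply, Finset.sum_mul_sum]
    exact Finset.sum_congr rfl fun i _ => Finset.sum_congr rfl fun l _ => by ring
  simp only [hexp]
  rw [integral_finsetSum _ fun i _ => integrable_finsetSum _ fun l _ => hint i l]
  simp only [integral_finsetSum _ fun l _ => hint _ l, integral_const_mul,
    integral_mul_of_iIndepFun_gaussian hind hlaw]
  simp only [mul_ite, mul_zero, Finset.sum_ite_eq, Finset.mem_univ, if_true, normalizedGram,
    Matrix.smul_apply, Matrix.mul_apply, Matrix.transpose_apply, smul_eq_mul, Finset.mul_sum]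
  exact Finset.sum_congr rfl fun i _ => by ring

/-- A centred Gaussian has the law of its standard deviation times a standard one. The standard
fourth moment is left unevaluated, since only the scaling in the variance matters. -/
lemma integral_pow_four_of_hasGaussianLaw [IsProbabilityMeasure P] {f : Ω → ℝ}
    (hf : HasGaussianLaw f P)
    (hmean : ∫ ω, f ω ∂P = 0) :
    ∫ ω, f ω ^ 4 ∂P = (∫ ω, f ω * f ω ∂P) ^ 2 * ∫ x, x ^ 4 ∂(gaussianReal 0 1) := by
  have hm := hf.memLp_two
  have hvar : Var[f; P] = ∫ ω, f ω * f ω ∂P := by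
    rw [← covariance_self hf.aemeasurable, covariance_eq_sub hm hm, hmean, mul_zero, sub_zero]
    rfl
  have hmap := hf.map_eq_gaussianReal
  rw [hmean] at hmap
  have h1 : gaussianReal 0 Var[f; P].toNNReal =
      (gaussianReal 0 1).map (fun x => √Var[f; P] * x) := by
    rw [gaussianReal_map_const_mul, mul_zero, mul_one]
    congr 1
    ext
    simp [Real.sq_sqrt (variance_nonneg f P), variance_nonneg f P]
  have h2 : ∫ ω, f ω ^ 4 ∂P = ∫ x, x ^ 4 ∂(P.map f) := by
    rw [integral_map hf.aemeasurable (by fun_prop)]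
  rw [h2, hmap, h1, integral_map (by fun_prop) (by fun_prop)]
  simp only [mul_pow, integral_const_mul]
  congr 1
  rw [show √Var[f; P] ^ 4 = (√Var[f; P] ^ 2) ^ 2 by ring, Real.sq_sqrt (variance_nonneg f P), hvar]

lemma integrable_noiseScore_pow_four (hind : iIndepFun e P)
    (hlaw : ∀ i, HasLaw (e i) (gaussianReal 0 v) P) (X : Matrix (Fin n) (Fin p) ℝ) (j : Fin p) :
    Integrable (fun ω => noiseScore X (fun i => e i ω) j ^ 4) P := by
  have h := ((hasGaussianLaw_noiseScore hind hlaw X).eval j).memLp (p := 4) (by norm_num)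
  have h' := h.integrable_norm_pow (p := 4) (by norm_num)
  refine h'.congr (ae_of_all _ fun ω => ?_)
  simp only [Real.norm_eq_abs]
  exact Even.pow_abs (by decide) _

lemma integral_sum_noiseScore_pow_four [IsProbabilityMeasure P] (hind : iIndepFun e P)
    (hlaw : ∀ i, HasLaw (e i) (gaussianReal 0 v) P) (X : Matrix (Fin n) (Fin p) ℝ) :
    ∫ ω, ∑ j, noiseScore X (fun i => e i ω) j ^ 4 ∂P =
      (v / n) ^ 2 * ((∑ j, normalizedGram X j j ^ 2) * ∫ x, x ^ 4 ∂(gaussianReal 0 1)) := by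
  rw [integral_finsetSum _ fun j _ => integrable_noiseScore_pow_four hind hlaw X j,
    Finset.sum_mul, Finset.mul_sum]
  refine Finset.sum_congr rfl fun j _ => ?_
  rw [integral_pow_four_of_hasGaussianLaw ((hasGaussianLaw_noiseScore hind hlaw X).eval j)
    (integral_noiseScore hlaw X j), integral_noiseScore_mul hind hlaw]
  ring

lemma norm_pow_four_le_sum (w : Fin p → ℝ) : ‖w‖ ^ 4 ≤ ∑ j, w j ^ 4 := by
  rcases isEmpty_or_nonempty (Fin p) with h | h
  · simp [Subsingleton.elim w 0]
  · obtain ⟨j, hj⟩ := Finite.exists_max fun j => ‖w j‖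
    have : ‖w‖ ≤ ‖w j‖ := (pi_norm_le_iff_of_nonneg (norm_nonneg _)).2 hj
    calc ‖w‖ ^ 4 ≤ ‖w j‖ ^ 4 := by gcongr
      _ = w j ^ 4 := by rw [Real.norm_eq_abs]; exact Even.pow_abs (by decide) _
      _ ≤ ∑ j, w j ^ 4 := Finset.single_le_sum (f := fun j => w j ^ 4)
          (fun i _ => Even.pow_nonneg (by decide) _) (Finset.mem_univ j)

lemma integral_mulVec_dotProduct_noiseScore [IsProbabilityMeasure P] (hind : iIndepFun e P)
    (hlaw : ∀ i, HasLaw (e i) (gaussianReal 0 v) P) (X : Matrix (Fin n) (Fin p) ℝ)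
    (N : Matrix (Fin p) (Fin p) ℝ) :
    ∫ ω, (N *ᵥ noiseScore X fun i => e i ω) ⬝ᵥ (noiseScore X fun i => e i ω) ∂P =
      v / n * (N * normalizedGram X).trace := by
  have hm (j : Fin p) : MemLp (fun ω => noiseScore X (fun i => e i ω) j) 2 P :=
    ((hasGaussianLaw_noiseScore hind hlaw X).eval j).memLp_two
  have hint (j k : Fin p) : Integrable (fun ω => N j k * (noiseScore X (fun i => e i ω) k *
      noiseScore X (fun i => e i ω) j)) P := ((hm k).integrable_mul (hm j)).const_mul _
  simp only [dotProduct, Matrix.mulVec, Finset.sum_mul, mul_assoc]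
  rw [integral_finsetSum _ fun i _ => integrable_finsetSum _ fun l _ => hint i l]
  simp only [integral_finsetSum _ fun l _ => hint _ l, integral_const_mul,
    integral_noiseScore_mul hind hlaw, Matrix.trace, Matrix.diag_apply, Matrix.mul_apply,
    Finset.mul_sum]
  exact Finset.sum_congr rfl fun i _ => Finset.sum_congr rfl fun l _ => by ring

lemma integral_const_dotProduct_noiseScore (hind : iIndepFun e P)
    (hlaw : ∀ i, HasLaw (e i) (gaussianReal 0 v) P) (X : Matrix (Fin n) (Fin p) ℝ)
    (u : Fin p → ℝ) : ∫ ω, u ⬝ᵥ (noiseScore X fun i => e i ω) ∂P = 0 := by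
  simp only [dotProduct]
  rw [integral_finsetSum _ fun j _ =>
    ((hasGaussianLaw_noiseScore hind hlaw X).eval j).integrable.const_mul _]
  simp [integral_const_mul, integral_noiseScore hlaw]

end noise

/-! ### Degrees of freedom of the lasso at fixed `n` -/

section lasso

variable {Ω : Type*} [MeasurableSpace Ω] {P : Measure Ω}
  {n p : ℕ} {e : Fin n → Ω → ℝ} {X : Matrix (Fin n) (Fin p) ℝ} {c lam : ℝ}
  {y : Ω → Fin n → ℝ} {βs : Fin p → ℝ}

/-- By uniqueness the chosen minimizer is a Lipschitz function of the Gaussian score, which gives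
both measurability and square integrability. -/
lemma memLp_lassoCoef [IsProbabilityMeasure P] {v : ℝ≥0} (hn : n ≠ 0) (hc : 0 < c)
    (hX : QuadLowerBound c (normalizedGram X)) (hlam : 0 ≤ lam / n) (hind : iIndepFun e P)
    (hlaw : ∀ i, HasLaw (e i) (gaussianReal 0 v) P) (hy : ∀ ω i, y ω i = (X *ᵥ βs) i + e i ω) :
    MemLp (fun ω => lassoCoef X (y ω) lam) 2 P := by
  choose f hf using fun W => exists_isPerturbedMinimizer hc hX βs W hlam
  have hlip : LipschitzWith (Real.toNNReal (p / c)) f := by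
    refine LipschitzWith.of_dist_le_mul fun W₁ W₂ => ?_
    rw [dist_eq_norm, dist_eq_norm, Real.coe_toNNReal _ (by positivity)]
    exact (hf W₁).norm_sub_le hc hX hlam (hf W₂)
  -- Subtracting `f 0` supplies the vanishing at `0` needed to compose with a square-integrable
  -- function.
  have hlip' : LipschitzWith (Real.toNNReal (p / c)) fun W => f W - f 0 := by
    refine LipschitzWith.of_dist_le_mul fun W₁ W₂ => ?_
    rw [dist_sub_right]
    exact hlip.dist_le_mul _ _
  have h := hlip'.comp_memLp (sub_self _) (hasGaussianLaw_noiseScore hind hlaw X).memLp_two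
  have h' := h.add (memLp_const (f 0))
  refine h'.ae_eq (ae_of_all _ fun ω => ?_)
  simp only [Pi.add_apply, Function.comp_apply, sub_add_cancel]
  exact (hf _).unique hc hX hlam (isPerturbedMinimizer_lassoCoef hn hc hX (hy ω) hlam)

lemma integrable_dotProduct_noiseScore {v : ℝ≥0} (hind : iIndepFun e P)
    (hlaw : ∀ i, HasLaw (e i) (gaussianReal 0 v) P) {B : Ω → Fin p → ℝ} (hB : MemLp B 2 P) :
    Integrable (fun ω => B ω ⬝ᵥ noiseScore X fun i => e i ω) P := by
  simp only [dotProduct]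
  refine integrable_finsetSum _ fun j _ => ?_
  exact (memLp_pi_iff.1 hB j).integrable_mul
    ((hasGaussianLaw_noiseScore hind hlaw X).eval j).memLp_two

/-- The mean of `y` drops out of the covariances and the noise is centred, so they sum to the mean
of `(X β̂) ⬝ᵥ e = n (β̂ ⬝ᵥ W)`. -/
lemma degreesOfFreedom_lassoFit [IsProbabilityMeasure P] {σ : ℝ≥0} (hn : n ≠ 0) (hc : 0 < c)
    (hX : QuadLowerBound c (normalizedGram X)) (hlam : 0 ≤ lam / n) (hind : iIndepFun e P)
    (hlaw : ∀ i, HasLaw (e i) (gaussianReal 0 (σ ^ 2)) P)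
    (hy : ∀ ω i, y ω i = (X *ᵥ βs) i + e i ω) :
    degreesOfFreedom P (lassoFit X lam) y σ =
      n / σ ^ 2 * ∫ ω, lassoCoef X (y ω) lam ⬝ᵥ noiseScore X (fun i => e i ω) ∂P := by
  have hB := memLp_lassoCoef hn hc hX hlam hind hlaw hy
  have hF (i : Fin n) : MemLp (fun ω => lassoFit X lam (y ω) i) 2 P := by
    simp only [lassoFit, Matrix.mulVec, dotProduct]
    exact memLp_finsetSum _ fun j _ => (memLp_pi_iff.1 hB j).const_mul _
  have he (i : Fin n) : MemLp (e i) 2 P := (hlaw i).hasGaussianLaw.memLp_two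
  have hcov (i : Fin n) : covariance (fun ω => lassoFit X lam (y ω) i) (fun ω => y ω i) P =
      ∫ ω, lassoFit X lam (y ω) i * e i ω ∂P := by
    simp only [hy _ i]
    rw [covariance_const_add_right (hlaw i).hasGaussianLaw.integrable,
      covariance_eq_sub (hF i) (he i), integral_eq_zero_of_hasLaw (hlaw i), mul_zero, sub_zero]
    rfl
  have hsum (ω : Ω) : ∑ i, lassoFit X lam (y ω) i * e i ω =
      n * (lassoCoef X (y ω) lam ⬝ᵥ noiseScore X fun i => e i ω) :=
    (natCast_mul_dotProduct_noiseScore hn X _ _).symm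
  rw [degreesOfFreedom, ← Finset.sum_div]
  simp only [hcov]
  rw [← integral_finsetSum (f := fun i ω => lassoFit X lam (y ω) i * e i ω) _
    fun i _ => (hF i).integrable_mul (he i)]
  simp only [hsum, integral_const_mul]
  ring

/-- If the lasso solution agrees with the restricted solution whenever the noise score has norm
less than `δ`, its degrees of freedom are close to the size of the active set. -/
lemma abs_degreesOfFreedom_sub_card_le [IsProbabilityMeasure P] {σ : ℝ≥0} (hσ : 0 < σ)
    (hn : n ≠ 0) (hc : 0 < c)
    (hX : QuadLowerBound c (normalizedGram X)) (hlam : 0 ≤ lam / n) (hind : iIndepFun e P)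
    (hlaw : ∀ i, HasLaw (e i) (gaussianReal 0 (σ ^ 2)) P)
    (hy : ∀ ω i, y ω i = (X *ᵥ βs) i + e i ω) {δ : ℝ} (hδ : 0 < δ) {A : Finset (Fin p)}
    {s : Fin p → ℝ} (hloc : ∀ W : Fin p → ℝ, ‖W‖ < δ → IsPerturbedMinimizer (normalizedGram X) βs W
      (lam / n) (restrictedSolution A s βs (normalizedGram X) W (lam / n))) :
    |degreesOfFreedom P (lassoFit X lam) y σ - A.card| ≤
      n / σ ^ 2 * (2 * p ^ 2 / (c * δ ^ 2) *
        ∫ ω, ∑ j, noiseScore X (fun i => e i ω) j ^ 4 ∂P) := by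
  have hn' : (n : ℝ) ≠ 0 := Nat.cast_ne_zero.2 hn
  have hσ' : (σ : ℝ) ≠ 0 := by exact_mod_cast hσ.ne'
  set W : Ω → Fin p → ℝ := fun ω => noiseScore X fun i => e i ω with hW
  set r : (Fin p → ℝ) → Fin p → ℝ :=
    fun w => restrictedSolution A s βs (normalizedGram X) w (lam / n) with hr
  set N := (restrictedGram A (normalizedGram X))⁻¹ * Matrix.diagonal (supportIndicator A) with hN
  have hgauss := hasGaussianLaw_noiseScore hind hlaw X
  have hB := memLp_lassoCoef hn hc hX hlam hind hlaw hy
  have hNW : MemLp (fun ω => N *ᵥ W ω) 2 P :=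
    (hgauss.map_fun N.mulVecLin.toContinuousLinearMap).memLp_two
  have hrW : MemLp (fun ω => r (W ω)) 2 P := by
    refine ((memLp_const (r 0)).add hNW).ae_eq (ae_of_all _ fun ω => ?_)
    exact (restrictedSolution_eq_add s βs (W ω) (lam / n)).symm
  have hmain : ∫ ω, r (W ω) ⬝ᵥ W ω ∂P = σ ^ 2 / n * A.card := by
    have hexp (ω : Ω) : r (W ω) ⬝ᵥ W ω = r 0 ⬝ᵥ W ω + (N *ᵥ W ω) ⬝ᵥ W ω := by
      rw [← add_dotProduct]
      exact congrArg (· ⬝ᵥ W ω) (restrictedSolution_eq_add s βs (W ω) (lam / n))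
    simp only [hexp]
    rw [integral_add (integrable_dotProduct_noiseScore hind hlaw (memLp_const _))
      (integrable_dotProduct_noiseScore hind hlaw hNW),
      integral_const_dotProduct_noiseScore hind hlaw, integral_mulVec_dotProduct_noiseScore hind
      hlaw, zero_add, trace_restrictedGram_inv_mul hc hX]
    push_cast
    rfl
  have hpt (ω : Ω) : |(lassoCoef X (y ω) lam - r (W ω)) ⬝ᵥ W ω| ≤
      2 * p ^ 2 / (c * δ ^ 2) * ∑ j, W ω j ^ 4 := by
    have hmin := isPerturbedMinimizer_lassoCoef hn hc hX (hy ω) hlam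
    refine le_trans ?_ (mul_le_mul_of_nonneg_left (norm_pow_four_le_sum (W ω)) (by positivity))
    rcases lt_or_ge ‖W ω‖ δ with hlt | hge
    · rw [hmin.unique hc hX hlam (hloc (W ω) hlt), sub_self, zero_dotProduct, abs_zero]
      positivity
    -- At zero noise the lasso and restricted solutions are both `r 0`, so at `W ω` each lies within
    -- `p / c * ‖W ω‖` of it.
    · have h1 := hmin.norm_sub_le hc hX hlam (hloc 0 (by simpa using hδ))
      have h2 := norm_restrictedSolution_sub_le (A := A) hc hX s βs 0 (W ω) (lam / n)
      rw [sub_zero] at h1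
      rw [zero_sub, norm_neg] at h2
      have h3 : ‖lassoCoef X (y ω) lam - r (W ω)‖ ≤ 2 * (p / c * ‖W ω‖) := by
        refine (norm_sub_le_norm_sub_add_norm_sub _ (r 0) _).trans ?_
        rw [two_mul]
        exact add_le_add h1 h2
      -- The mean of `‖W‖²` is only `O(1 / n)`, which the prefactor `n / σ²` would cancel; trading
      -- `δ²` for `‖W‖²` raises the power to four.
      have h4 : δ ^ 2 ≤ ‖W ω‖ ^ 2 := by gcongr
      calc |(lassoCoef X (y ω) lam - r (W ω)) ⬝ᵥ W ω|
          ≤ p * (2 * (p / c * ‖W ω‖) * ‖W ω‖) :=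
            (abs_dotProduct_le _ _).trans (by gcongr)
        _ = 2 * p ^ 2 / (c * δ ^ 2) * (‖W ω‖ ^ 2 * δ ^ 2) := by field_simp
        _ ≤ 2 * p ^ 2 / (c * δ ^ 2) * (‖W ω‖ ^ 2 * ‖W ω‖ ^ 2) := by gcongr
        _ = 2 * p ^ 2 / (c * δ ^ 2) * ‖W ω‖ ^ 4 := by ring
  have hdiff : degreesOfFreedom P (lassoFit X lam) y σ - A.card =
      n / σ ^ 2 * ∫ ω, (lassoCoef X (y ω) lam - r (W ω)) ⬝ᵥ W ω ∂P := by
    simp only [sub_dotProduct]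
    rw [integral_sub (integrable_dotProduct_noiseScore hind hlaw hB)
      (integrable_dotProduct_noiseScore hind hlaw hrW), hmain,
      degreesOfFreedom_lassoFit hn hc hX hlam hind hlaw hy]
    field_simp
  rw [hdiff, abs_mul, abs_of_nonneg (by positivity : (0 : ℝ) ≤ n / σ ^ 2), ← integral_const_mul]
  refine mul_le_mul_of_nonneg_left ((abs_integral_le_integral_abs).trans ?_) (by positivity)
  exact integral_mono
    (integrable_dotProduct_noiseScore hind hlaw (hB.sub hrW)).abs
    ((integrable_finsetSum _ fun j _ => integrable_noiseScore_pow_four hind hlaw X j).const_mul _)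
    hpt

end lasso

/-! ### Passage to the limit -/

theorem theorem2 {Ω : Type*} [MeasurableSpace Ω] (P : Measure Ω) [IsProbabilityMeasure P]
    (p : ℕ) (βs : Fin p → ℝ) (σ : ℝ≥0) (hσ : 0 < σ)
    (X : ∀ n : ℕ, Matrix (Fin n) (Fin p) ℝ)
    (ε : ∀ n : ℕ, Fin n → Ω → ℝ)
    (hε_indep : ∀ n, iIndepFun (ε n) P)
    (hε_law : ∀ n i, HasLaw (ε n i) (gaussianReal 0 (σ ^ 2)) P)
    (y : ∀ n : ℕ, Ω → Fin n → ℝ)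
    (hy : ∀ n ω i, y n ω i = (X n *ᵥ βs) i + ε n i ω)
    (C : Matrix (Fin p) (Fin p) ℝ) (hC : C.PosDef)
    (hX : Tendsto (fun n : ℕ => (1 / (n : ℝ)) • ((X n)ᵀ * X n)) atTop (𝓝 C))
    (lam : ℕ → ℝ) (lamStar : ℝ) (hlamStar : 0 < lamStar)
    (hlam : Tendsto (fun n : ℕ => lam n / (n : ℝ)) atTop (𝓝 lamStar))
    (hnontransition : ¬ IsTransitionPoint (limitCoef C βs) lamStar)
    (hnondegenerate : ∀ j, ¬ IsDegenerateAt C βs lamStar j) :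
    TendstoInMeasure P
      (fun (n : ℕ) (ω : Ω) =>
        ((activeSet (lassoCoef (X n) (y n ω) (lam n))).card : ℝ)
          - degreesOfFreedom P (lassoFit (X n) (lam n)) (y n) (σ : ℝ))
      atTop (fun _ => (0 : ℝ)) := by
  obtain ⟨c, hc, hq⟩ := eventually_quadLowerBound hC
  set b := limitCoef C βs lamStar with hb
  obtain ⟨δ, hδ, hloc⟩ := exists_eventually_isPerturbedMinimizer_restrictedSolution hC hlamStar
    (isPerturbedMinimizer_limitCoef hC βs hlamStar.le)
    fun j hj => abs_gradient_lt_of_not_isDegenerateAt hC βs hlamStar hnontransition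
      (hnondegenerate j) hj
  set W : ∀ n : ℕ, Ω → Fin p → ℝ := fun n ω => noiseScore (X n) fun i => ε n i ω with hW
  set S : ℕ → ℝ := fun n => ∫ ω, ∑ j, W n ω j ^ 4 ∂P with hS
  have hdiag : Tendsto (fun n : ℕ => ∑ j, normalizedGram (X n) j j ^ 2) atTop
      (𝓝 (∑ j, C j j ^ 2)) := by
    refine tendsto_finsetSum _ fun j _ => Tendsto.pow ?_ 2
    exact ((continuous_id.matrix_elem j j).tendsto C).comp hX
  have hSeq (n : ℕ) : S n = (((σ ^ 2 : ℝ≥0) : ℝ) / n) ^ 2 *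
      ((∑ j, normalizedGram (X n) j j ^ 2) * ∫ x, x ^ 4 ∂(gaussianReal 0 1)) :=
    integral_sum_noiseScore_pow_four (hε_indep n) (hε_law n) (X n)
  have hS0 : Tendsto S atTop (𝓝 0) := by
    have h := ((tendsto_const_div_atTop_nhds_zero_nat ((σ ^ 2 : ℝ≥0) : ℝ)).pow 2).mul
      (hdiag.mul_const (∫ x, x ^ 4 ∂(gaussianReal 0 1)))
    rw [zero_pow two_ne_zero, zero_mul] at h
    exact h.congr fun n => (hSeq n).symm
  set K : ℝ := 2 * p ^ 2 / (c * δ ^ 2) with hK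
  -- Since `S n` is `O(n⁻²)`, one factor `1 / n` is left after multiplying by `n`.
  have hD0 : Tendsto (fun n : ℕ => n / (σ : ℝ) ^ 2 * (K * S n)) atTop (𝓝 0) := by
    have h := (tendsto_const_div_atTop_nhds_zero_nat ((σ : ℝ) ^ 2 * K)).mul
      (hdiag.mul_const (∫ x, x ^ 4 ∂(gaussianReal 0 1)))
    rw [zero_mul] at h
    refine h.congr' ?_
    filter_upwards [eventually_ne_atTop 0] with n hn
    have hn' : (n : ℝ) ≠ 0 := Nat.cast_ne_zero.2 hn
    have hσ' : (σ : ℝ) ≠ 0 := by exact_mod_cast hσ.ne'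
    rw [hSeq]
    push_cast
    field_simp
  have hpair : Tendsto (fun n : ℕ => (normalizedGram (X n), lam n / n)) atTop
      (𝓝 (C, lamStar)) := hX.prodMk_nhds hlam
  rw [tendstoInMeasure_iff_norm]
  intro η hη
  refine tendsto_of_tendsto_of_tendsto_of_le_of_le' (h := fun n => ENNReal.ofReal (S n / δ ^ 4))
    tendsto_const_nhds ?_ (Eventually.of_forall fun _ => zero_le) ?_
  · have h := ENNReal.tendsto_ofReal (hS0.div_const (δ ^ 4))
    rwa [zero_div, ENNReal.ofReal_zero] at h
  filter_upwards [eventually_ne_atTop 0, hX.eventually hq, hpair.eventually hloc,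
    hlam.eventually_const_lt hlamStar, hD0.eventually_lt_const hη] with n hn hqn hlocn hlamn hDn
  have hlocn' := hlocn (normalizedGram_transpose (X n))
  have hdf := (abs_degreesOfFreedom_sub_card_le hσ hn hc hqn hlamn.le (hε_indep n) (hε_law n)
    (hy n) hδ fun w hw => (hlocn' w hw).1).trans_lt hDn
  -- When `‖W‖ < δ` the lasso active set is exactly the limiting one, so the deviation is the
  -- deterministic gap in `hdf`, already below `η`. A deviation of `η` therefore forces a large
  -- score, and Markov's inequality applies.
  have hsub : {ω | η ≤ ‖((activeSet (lassoCoef (X n) (y n ω) (lam n))).card : ℝ)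
      - degreesOfFreedom P (lassoFit (X n) (lam n)) (y n) (σ : ℝ) - 0‖} ⊆
      {ω | δ ^ 4 ≤ ∑ j, W n ω j ^ 4} := by
    intro ω hω
    by_contra hlt
    have hlt' : ‖W n ω‖ < δ := by
      refine lt_of_pow_lt_pow_left₀ 4 hδ.le ((norm_pow_four_le_sum _).trans_lt ?_)
      exact not_le.1 hlt
    obtain ⟨h1, h2⟩ := hlocn' (W n ω) hlt'
    have hcoef := (isPerturbedMinimizer_lassoCoef hn hc hqn (hy n ω) hlamn.le).unique hc hqn
      hlamn.le h1
    refine absurd (Set.mem_ofPred_eq ▸ hω) (not_le.2 ?_)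
    rw [sub_zero, Real.norm_eq_abs, abs_sub_comm, hcoef, h2]
    exact hdf
  have hmarkov : δ ^ 4 * P.real {ω | δ ^ 4 ≤ ∑ j, W n ω j ^ 4} ≤ S n :=
    mul_meas_ge_le_integral_of_nonneg
      (ae_of_all _ fun ω => Finset.sum_nonneg fun j _ => Even.pow_nonneg (by decide) _)
      (integrable_finsetSum _ fun j _ =>
        integrable_noiseScore_pow_four (hε_indep n) (hε_law n) (X n) j) _
  refine (measure_mono hsub).trans ?_
  rw [← ofReal_measureReal]
  refine ENNReal.ofReal_le_ofReal ?_
  rw [le_div_iff₀ (by positivity)]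
  linarith
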